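/- Let $n\ge 1$, let $\mathcal X_1,\dots,\mathcal X_n$ be record universes (second countable topological spaces with their Borel $\sigma$-algebras, for example subsets of $\mathbb R^{d_i}$), and let $\mathcal X=\prod_{i=1}^n\mathcal X_i$. Let $f:\mathcal X\to\mathbb R$ be a continuous query function with $f(x)\in[-T,T]$ for all $x\in\mathcal X$, where $T>0$. For $N>0$ let $p(y|x)$ be the Gaussian privacy channel of $f$ with parameter $N$: given the dataset $x\in\mathcal X$, its real-valued output $Y$ has the normal distribution $\mathcal N(f(x),N)$ with mean $f(x)$ and variance $N$. Let $\mathbb P$ be the set of all probability distributions on $\mathcal X$, and let $$C_1=\sup_{1\le i\le n}\ \sup_{X=(X_1,\dots,X_n)\sim P\in\mathbb P} I(X_i;Y)$$ be the individual channel capacity of $p(y|x)$ with respect to $\mathbb P$, where $I(X_i;Y)$ is the mutual information (natural logarithm) between the $i$-th record and the output, i.e. the Kullback–Leibler divergence of the joint law of $(X_i,Y)$ from the product of its marginals. Then $$C_1\le\frac12\log\Bigl(1+\frac{T^2}{N}\Bigr).$$ Consequently, for every $\varepsilon>0$, if $N\ge \dfrac{T^2}{e^{2\varepsilon}-1}$,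 then the channel satisfies $\varepsilon$-information privacy with respect to $\mathbb P$, that is, $C_1\le\varepsilon$. -/

import Mathlib

open MeasureTheory ProbabilityTheory InformationTheory
open scoped NNReal ENNReal

/-- The mutual information `I(U; V)` (in nats) of a pair `(U, V)` with joint law `ρ`: the
Kullback-Leibler divergence of the joint law from the product of its two marginals. When `ρ` has a
density `p(u, v)` with respect to a product measure, this is the integral of
`p(u, v) log (p(u, v) / (p(u) p(v)))`. -/
noncomputable def mutualInfo {α β : Type*} [MeasurableSpace α] [MeasurableSpace β]
    (ρ : Measure (α × β)) : ℝ≥0∞ :=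
  klDiv ρ (ρ.fst.prod ρ.snd)

section PrivacyChannel

variable {n : ℕ} {𝒳 : Fin n → Type*} [∀ i, MeasurableSpace (𝒳 i)]
  {𝒴 : Type*} [MeasurableSpace 𝒴]

/-- The joint law of the record `X i` and the output `Y`, when the dataset `X = (X 1, …, X n)` has
law `P` and, given `X = x`, the output `Y` has law `κ x`. -/
noncomputable def recordOutputLaw (κ : Kernel (∀ i, 𝒳 i) 𝒴)
    (P : ProbabilityMeasure (∀ i, 𝒳 i)) (i : Fin n) : Measure (𝒳 i × 𝒴) :=
  ((P : Measure (∀ i, 𝒳 i)) ⊗ₘ κ).map (fun z => (z.1 i, z.2))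

/-- The individual channel capacity `C₁` of the privacy channel (Markov
kernel) `κ` with respect to a set `Δ` of
probability distributions on the datasets: the supremum of `I(X i; Y)` over the individuals `i`
and over the laws of `X` in `Δ`. -/
noncomputable def individualChannelCapacity (κ : Kernel (∀ i, 𝒳 i) 𝒴)
    (Δ : Set (ProbabilityMeasure (∀ i, 𝒳 i))) : ℝ≥0∞ :=
  ⨆ (i : Fin n) (P ∈ Δ), mutualInfo (recordOutputLaw κ P i)

/-- A smaller class of distributions (for instance those with a density) has a smaller capacity. -/
theorem individualChannelCapacity_mono (κ : Kernel (∀ i, 𝒳 i) 𝒴)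
    {Δ Δ' : Set (ProbabilityMeasure (∀ i, 𝒳 i))} (h : Δ ⊆ Δ') :
    individualChannelCapacity κ Δ ≤ individualChannelCapacity κ Δ' :=
  iSup_mono fun _ => biSup_mono fun _ hP => h hP

/-- `ε`-information privacy of the channel `κ` with respect to `Δ`. -/
def InformationPrivacy (κ : Kernel (∀ i, 𝒳 i) 𝒴)
    (Δ : Set (ProbabilityMeasure (∀ i, 𝒳 i))) (ε : ℝ≥0) : Prop :=
  individualChannelCapacity κ Δ ≤ ε

/-- A channel with real output is the Gaussian privacy channel of the query `f` with parameter
(noise variance) `N` if its output on the dataset `x` has law `𝒩(f x, N)`. -/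
def IsGaussianPrivacyChannel (f : (∀ i, 𝒳 i) → ℝ) (N : ℝ≥0)
    (κ : Kernel (∀ i, 𝒳 i) ℝ) : Prop :=
  ∀ x, κ x = gaussianReal (f x) N

/-- A measurable query has a Gaussian privacy channel, for every parameter. -/
theorem exists_isGaussianPrivacyChannel {f : (∀ i, 𝒳 i) → ℝ} (hf : Measurable f) (N : ℝ≥0) :
    ∃ κ : Kernel (∀ i, 𝒳 i) ℝ, IsGaussianPrivacyChannel f N κ := by
  refine ⟨((Kernel.const _ (gaussianReal 0 N)) ×ₖ (Kernel.deterministic f hf)).map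
    (fun z => z.1 + z.2), fun x => ?_⟩
  rw [Kernel.map_apply _ (by fun_prop), Kernel.prod_apply, Kernel.const_apply,
    Kernel.deterministic_apply, Measure.prod_dirac, Measure.map_map (by fun_prop) (by fun_prop)]
  have h := gaussianReal_map_add_const (μ := 0) (v := N) (f x)
  rw [zero_add] at h
  exact h

end PrivacyChannel

/-!
# Capacity of the Gaussian privacy channel

Write `ρ = P ⊗ₘ κ` for the joint law of the dataset `X` and the output `Y`. Since `(X i, Y)` is a
function of `(X, Y)`, the data processing inequality gives `I(X i; Y) ≤ I(X; Y)`
(`mutualInfo_recordOutputLaw_le`), so it suffices to bound `I(X; Y)`, the divergence of `ρ` from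
`P ⊗ P_Y`.

Replacing the output marginal `P_Y` by any other law `Q` can only increase the divergence, because
`D(ρ ‖ P ⊗ Q) = D(P_Y ‖ Q) + D(ρ ‖ P ⊗ P_Y)` (`klDiv_compProd_prod_snd_le`). This is the chain rule
for the disintegration of `ρ` over the output. The record spaces are not assumed to be standard
Borel, so the posterior kernel is not available from general theory; it is built by Bayes' formula
from the density of `κ x` with respect to `Q` (`map_swap_compProd_eq_of_density`).

Choose `Q = 𝒩(0, N + T ^ 2)`. Then `D(𝒩(f x, N) ‖ Q)` equals
`1 / 2 * log ((N + T ^ 2) / N) - 1 / 2 + (N + f x ^ 2) / (2 * (N + T ^ 2))`, which is at most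
`1 / 2 * log (1 + T ^ 2 / N)` as `|f x| ≤ T`; averaging over `x` gives
`klDiv_compProd_prod_gaussianReal_le`.
-/

/-! ### Channels with a density and the variational bound on mutual information -/

section DensityKernel

variable {α β : Type*} [MeasurableSpace α] [MeasurableSpace β]
  {P : Measure α} [IsProbabilityMeasure P] {κ : Kernel α β} [IsMarkovKernel κ]
  {Q : Measure β} [IsProbabilityMeasure Q] {h : α → β → ℝ≥0∞}

theorem compProd_eq_withDensity_of_density (hh : Measurable (Function.uncurry h))
    (hκ : ∀ x, κ x = Q.withDensity (h x)) :
    P ⊗ₘ κ = (P.prod Q).withDensity (Function.uncurry h) := by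
  refine Measure.ext_of_lintegral _ fun g hg => ?_
  rw [Measure.lintegral_compProd hg, lintegral_withDensity_eq_lintegral_mul _ hh hg,
    lintegral_prod _ (hh.mul hg).aemeasurable]
  refine lintegral_congr fun x => ?_
  rw [hκ, lintegral_withDensity_eq_lintegral_mul _ hh.of_uncurry_left (by fun_prop)]
  rfl

theorem snd_compProd_eq_withDensity_of_density (hh : Measurable (Function.uncurry h))
    (hκ : ∀ x, κ x = Q.withDensity (h x)) :
    (P ⊗ₘ κ).snd = Q.withDensity fun y => ∫⁻ x, h x y ∂P := by
  refine Measure.ext_of_lintegral _ fun g hg => ?_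
  have hp : Measurable fun y => ∫⁻ x, h x y ∂P := hh.lintegral_prod_left'
  have hg' : Measurable fun z : α × β => g z.2 := hg.comp measurable_snd
  rw [Measure.snd, lintegral_map hg measurable_snd, compProd_eq_withDensity_of_density hh hκ,
    lintegral_withDensity_eq_lintegral_mul _ hh (by fun_prop),
    lintegral_withDensity_eq_lintegral_mul _ hp hg,
    lintegral_prod_symm _ (hh.mul hg').aemeasurable]
  refine lintegral_congr fun y => ?_
  exact lintegral_mul_const (f := fun x => h x y) (g y) hh.of_uncurry_right

/-- Bayes' formula: when the channel has a density `h x y` with respect to a law `Q`, and the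
output density `∫⁻ x, h x y ∂P` vanishes nowhere and is finite, the joint law disintegrates over the
output, without any assumption on the input space. -/
theorem map_swap_compProd_eq_of_density (hh : Measurable (Function.uncurry h))
    (hκ : ∀ x, κ x = Q.withDensity (h x))
    (hpos : ∀ y, ∫⁻ x, h x y ∂P ≠ 0) (hfin : ∀ y, ∫⁻ x, h x y ∂P ≠ ∞) :
    ∃ η : Kernel β α, IsMarkovKernel η ∧
      (P ⊗ₘ κ).map Prod.swap = (P ⊗ₘ κ).snd ⊗ₘ η := by
  have hp : Measurable fun y => ∫⁻ x, h x y ∂P := hh.lintegral_prod_left'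
  have hd : Measurable (Function.uncurry fun y x => h x y / ∫⁻ x', h x' y ∂P) :=
    (hh.comp measurable_swap).div (hp.comp measurable_fst)
  have hη : ∀ y, (Kernel.const β P).withDensity (fun y x => h x y / ∫⁻ x', h x' y ∂P) y =
      P.withDensity fun x => h x y / ∫⁻ x', h x' y ∂P := fun y => by
    rw [Kernel.withDensity_apply _ hd, Kernel.const_apply]
  have hM : IsMarkovKernel
      ((Kernel.const β P).withDensity fun y x => h x y / ∫⁻ x', h x' y ∂P) := by
    refine ⟨fun y => ⟨?_⟩⟩
    rw [hη, withDensity_apply _ MeasurableSet.univ, Measure.restrict_univ]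
    simp_rw [div_eq_mul_inv]
    rw [lintegral_mul_const _ hh.of_uncurry_right]
    exact ENNReal.mul_inv_cancel (hpos y) (hfin y)
  refine ⟨_, hM, Measure.ext_of_lintegral _ fun g hg => ?_⟩
  have hg' : Measurable fun z : α × β => g z.swap := hg.comp measurable_swap
  rw [lintegral_map hg measurable_swap, Measure.lintegral_compProd hg,
    snd_compProd_eq_withDensity_of_density hh hκ, compProd_eq_withDensity_of_density hh hκ,
    lintegral_withDensity_eq_lintegral_mul _ hh (by fun_prop),
    lintegral_withDensity_eq_lintegral_mul _ hp hg.lintegral_kernel_prod_right',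
    lintegral_prod_symm _ (hh.mul hg').aemeasurable]
  refine lintegral_congr fun y => ?_
  have hgy : Measurable fun x => g (y, x) := by fun_prop
  rw [Pi.mul_apply, hη, lintegral_withDensity_eq_lintegral_mul _ hd.of_uncurry_left hgy,
    ← lintegral_const_mul _ (hd.of_uncurry_left.mul hgy)]
  refine lintegral_congr fun x => ?_
  simp only [Pi.mul_apply, Function.uncurry_apply_pair, Prod.swap_prod_mk]
  rw [← mul_assoc, ENNReal.mul_div_cancel (hpos y) (hfin y)]

/-- Among the product laws `P ⊗ Q`, the one whose second factor is the true output law is closest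
to the joint law of input and output: the two divergences differ by `D(P_Y ‖ Q)`. -/
theorem klDiv_compProd_prod_snd_le (hh : Measurable (Function.uncurry h))
    (hκ : ∀ x, κ x = Q.withDensity (h x))
    (hpos : ∀ y, ∫⁻ x, h x y ∂P ≠ 0) (hfin : ∀ y, ∫⁻ x, h x y ∂P ≠ ∞) :
    klDiv (P ⊗ₘ κ) (P.prod (P ⊗ₘ κ).snd) ≤ klDiv (P ⊗ₘ κ) (P.prod Q) := by
  obtain ⟨η, hη, hswap⟩ := map_swap_compProd_eq_of_density hh hκ hpos hfin
  have hswap' : P ⊗ₘ κ = ((P ⊗ₘ κ).snd ⊗ₘ η).map Prod.swap := by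
    rw [← hswap, Measure.map_map measurable_swap measurable_swap]
    simp
  calc klDiv (P ⊗ₘ κ) (P.prod (P ⊗ₘ κ).snd)
      = klDiv (((P ⊗ₘ κ).snd ⊗ₘ η).map Prod.swap) (((P ⊗ₘ κ).snd.prod P).map Prod.swap) := by
        rw [← hswap', Measure.prod_swap]
    _ ≤ klDiv ((P ⊗ₘ κ).snd ⊗ₘ η) ((P ⊗ₘ κ).snd.prod P) := klDiv_map_le _ _ measurable_swap
    _ ≤ klDiv ((P ⊗ₘ κ).snd ⊗ₘ η) (Q.prod P) := by
        rw [← Measure.compProd_const, ← Measure.compProd_const,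
          klDiv_compProd_eq_add (P ⊗ₘ κ).snd Q]
        exact le_add_self
    _ = klDiv ((P ⊗ₘ κ).map Prod.swap) ((P.prod Q).map Prod.swap) := by
        rw [hswap, Measure.prod_swap]
    _ ≤ klDiv (P ⊗ₘ κ) (P.prod Q) := klDiv_map_le _ _ measurable_swap

end DensityKernel

/-! ### Gaussian channels with a bounded mean -/

section Gaussian

theorem integrable_sq_sub_gaussianReal (m : ℝ) (v : ℝ≥0) (c : ℝ) :
    Integrable (fun y => (y - c) ^ 2) (gaussianReal m v) :=
  ((memLp_id_gaussianReal' 2 (by simp)).sub (memLp_const c)).integrable_sq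

theorem integral_sq_sub_gaussianReal (m : ℝ) (v : ℝ≥0) (c : ℝ) :
    ∫ y, (y - c) ^ 2 ∂gaussianReal m v = v + (m - c) ^ 2 := by
  have hvar : ∫ y, (y - m) ^ 2 ∂gaussianReal m v = v := by
    have h := variance_id_gaussianReal (μ := m) (v := v)
    rw [variance_eq_integral measurable_id.aemeasurable] at h
    simpa [integral_id_gaussianReal] using h
  have hid : Integrable (fun y : ℝ => y) (gaussianReal m v) :=
    (memLp_id_gaussianReal' 1 (by simp)).integrable le_rfl
  have hlin : Integrable (fun y : ℝ => 2 * (m - c) * (y - m)) (gaussianReal m v) :=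
    (hid.sub (integrable_const m)).const_mul _
  have hsum : Integrable (fun y => (y - m) ^ 2 + 2 * (m - c) * (y - m)) (gaussianReal m v) :=
    (integrable_sq_sub_gaussianReal m v m).add hlin
  calc ∫ y, (y - c) ^ 2 ∂gaussianReal m v
      = ∫ y, ((y - m) ^ 2 + 2 * (m - c) * (y - m) + (m - c) ^ 2) ∂gaussianReal m v := by
        congr with y; ring
    _ = v + (m - c) ^ 2 := by
        rw [integral_add hsum (integrable_const _),
          integral_add (integrable_sq_sub_gaussianReal m v m) hlin, hvar, integral_const_mul,
          integral_sub hid (integrable_const m), integral_id_gaussianReal]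
        simp

theorem log_gaussianPDFReal_div {m m' : ℝ} {v w : ℝ≥0} (hv : v ≠ 0) (hw : w ≠ 0) (y : ℝ) :
    Real.log (gaussianPDFReal m v y / gaussianPDFReal m' w y) =
      1 / 2 * Real.log (w / v) - (y - m) ^ 2 / (2 * v) + (y - m') ^ 2 / (2 * w) := by
  have hv' : (0 : ℝ) < v := by positivity
  have hw' : (0 : ℝ) < w := by positivity
  rw [Real.log_div (gaussianPDFReal_pos _ _ _ hv).ne' (gaussianPDFReal_pos _ _ _ hw).ne',
    gaussianPDFReal, gaussianPDFReal, Real.log_mul (by positivity) (by positivity),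
    Real.log_mul (by positivity) (by positivity), Real.log_exp, Real.log_exp, Real.log_inv,
    Real.log_inv, Real.log_sqrt (by positivity), Real.log_sqrt (by positivity),
    Real.log_mul (by positivity) hv'.ne', Real.log_mul (by positivity) hw'.ne',
    Real.log_div hw'.ne' hv'.ne']
  ring

theorem gaussianReal_eq_withDensity_gaussianReal (m m' : ℝ) {v w : ℝ≥0} (hv : v ≠ 0)
    (hw : w ≠ 0) :
    gaussianReal m v =
      (gaussianReal m' w).withDensity fun y => gaussianPDF m v y / gaussianPDF m' w y := by
  rw [gaussianReal_of_var_ne_zero _ hv, gaussianReal_of_var_ne_zero _ hw,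
    ← withDensity_mul _ (by fun_prop) (by fun_prop)]
  congr with y
  exact (ENNReal.mul_div_cancel (gaussianPDF_pos _ hw y).ne' gaussianPDF_ne_top).symm

variable {α : Type*} [MeasurableSpace α] {P : Measure α} [IsProbabilityMeasure P]
  {κ : Kernel α ℝ} [IsMarkovKernel κ] {f : α → ℝ} {T : ℝ} {N : ℝ≥0}

theorem measurable_gaussianPDF_div (hf : Measurable f) (v w : ℝ≥0) (m : ℝ) :
    Measurable (Function.uncurry fun x y => gaussianPDF (f x) v y / gaussianPDF m w y) :=
  (measurable_uncurry_gaussianPDF.comp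
    ((hf.comp measurable_fst).prodMk (measurable_const.prodMk measurable_snd))).div
    ((measurable_gaussianPDF m w).comp measurable_snd)

/-- The reference law `𝒩(0, N + T ^ 2)` is the output law of the channel when its input is itself
Gaussian, with the largest second moment that `|f x| ≤ T` allows. -/
theorem klDiv_compProd_prod_gaussianReal_le (hf : Measurable f) (hfT : ∀ x, |f x| ≤ T)
    (hN : N ≠ 0) (hκ : ∀ x, κ x = gaussianReal (f x) N) {M : ℝ≥0} (hM : (M : ℝ) = N + T ^ 2) :
    klDiv (P ⊗ₘ κ) (P.prod (gaussianReal 0 M)) ≤ ENNReal.ofReal (1 / 2 * Real.log (M / N)) := by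
  have hN' : (0 : ℝ) < N := by positivity
  have hM' : (0 : ℝ) < M := by rw [hM]; positivity
  have hM0 : M ≠ 0 := by exact_mod_cast hM'.ne'
  have hsq : ∀ x, f x ^ 2 ≤ T ^ 2 := fun x => sq_le_sq' (abs_le.1 (hfT x)).1 (abs_le.1 (hfT x)).2
  have hh := measurable_gaussianPDF_div hf N M 0
  have hdens := compProd_eq_withDensity_of_density (P := P) hh fun x =>
    (hκ x).trans (gaussianReal_eq_withDensity_gaussianReal (f x) 0 hN hM0)
  have hac : P ⊗ₘ κ ≪ P.prod (gaussianReal 0 M) := by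
    rw [hdens]; exact withDensity_absolutelyContinuous _ _
  set φ : α × ℝ → ℝ := fun z =>
    1 / 2 * Real.log (M / N) - (z.2 - f z.1) ^ 2 / (2 * N) + (z.2 - 0) ^ 2 / (2 * M) with hφ
  have hllr : llr (P ⊗ₘ κ) (P.prod (gaussianReal 0 M)) =ᵐ[P ⊗ₘ κ] φ := by
    refine hac.ae_eq ?_
    have hrn := Measure.rnDeriv_withDensity (P.prod (gaussianReal 0 M)) hh
    rw [← hdens] at hrn
    filter_upwards [hrn] with z hz
    rw [llr, hz, Function.uncurry, ENNReal.toReal_div, toReal_gaussianPDF, toReal_gaussianPDF,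
      log_gaussianPDFReal_div hN hM0]
  have hfst : Measurable fun z : α × ℝ => f z.1 := hf.comp measurable_fst
  have hint₁ : Integrable (fun z : α × ℝ => (z.2 - f z.1) ^ 2) (P ⊗ₘ κ) := by
    rw [Measure.integrable_compProd_iff (by fun_prop)]
    refine ⟨ae_of_all _ fun x => ?_, ?_⟩
    · rw [hκ]; exact integrable_sq_sub_gaussianReal (f x) N (f x)
    · simp [hκ, integral_sq_sub_gaussianReal]
  have hint₂ : Integrable (fun z : α × ℝ => (z.2 - 0) ^ 2) (P ⊗ₘ κ) := by
    refine ((hint₁.const_mul 2).add (integrable_const (2 * T ^ 2))).mono' (by fun_prop)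
      (ae_of_all _ fun z => ?_)
    rw [Real.norm_of_nonneg (by positivity)]
    simp only [Pi.add_apply]
    -- `y ^ 2 ≤ 2 * (y - f x) ^ 2 + 2 * f x ^ 2`, the difference being `(y - 2 * f x) ^ 2`
    nlinarith [sq_nonneg (z.2 - 2 * f z.1), hsq z.1]
  have hint : Integrable φ (P ⊗ₘ κ) :=
    ((integrable_const _).sub (hint₁.div_const _)).add (hint₂.div_const _)
  rw [klDiv_of_ac_of_integrable hac ((integrable_congr hllr).2 hint), integral_congr_ae hllr]
  simp only [probReal_univ, add_sub_cancel_right]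
  refine ENNReal.ofReal_le_ofReal ?_
  have hinner : ∀ x, ∫ y, φ (x, y) ∂κ x ≤ 1 / 2 * Real.log (M / N) := fun x => by
    have hcalc : ∫ y, φ (x, y) ∂κ x =
        1 / 2 * Real.log (M / N) - N / (2 * N) + (N + f x ^ 2) / (2 * M) := by
      have h₁ := (integrable_sq_sub_gaussianReal (f x) N (f x)).div_const (2 * (N : ℝ))
      have h₂ := (integrable_sq_sub_gaussianReal (f x) N 0).div_const (2 * (M : ℝ))
      have h₃ : Integrable (fun y => 1 / 2 * Real.log (M / N) - (y - f x) ^ 2 / (2 * N))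
          (gaussianReal (f x) N) := (integrable_const _).sub h₁
      simp only [hφ]
      rw [hκ, integral_add h₃ h₂, integral_sub (integrable_const _) h₁,
        integral_div, integral_div, integral_sq_sub_gaussianReal, integral_sq_sub_gaussianReal]
      simp
    have h₁ : (N : ℝ) / (2 * N) = 1 / 2 := by field_simp
    have h₂ : ((N : ℝ) + f x ^ 2) / (2 * M) ≤ 1 / 2 := by
      rw [div_le_div_iff₀ (by positivity) two_pos]
      linarith [hsq x]
    linarith
  have hinner_int : Integrable (fun x => ∫ y, φ (x, y) ∂κ x) P := by
    rw [Measure.compProd] at hint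
    simpa using hint.integral_compProd
  rw [Measure.integral_compProd hint]
  calc ∫ x, ∫ y, φ (x, y) ∂κ x ∂P ≤ ∫ _, 1 / 2 * Real.log (M / N) ∂P :=
        integral_mono hinner_int (integrable_const _) hinner
    _ = 1 / 2 * Real.log (M / N) := by simp

theorem klDiv_compProd_prod_snd_gaussian_le (hf : Measurable f) (hfT : ∀ x, |f x| ≤ T)
    (hN : N ≠ 0) (hκ : ∀ x, κ x = gaussianReal (f x) N) :
    klDiv (P ⊗ₘ κ) (P.prod (P ⊗ₘ κ).snd) ≤
      ENNReal.ofReal (1 / 2 * Real.log (1 + T ^ 2 / (N : ℝ))) := by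
  have hN' : (0 : ℝ) < N := by positivity
  obtain ⟨M, hM⟩ : ∃ M : ℝ≥0, (M : ℝ) = N + T ^ 2 := ⟨⟨N + T ^ 2, by positivity⟩, rfl⟩
  have hM0 : M ≠ 0 := by
    have : (0 : ℝ) < M := by rw [hM]; positivity
    exact_mod_cast this.ne'
  have hh := measurable_gaussianPDF_div hf N M 0
  have hquot : 1 + T ^ 2 / (N : ℝ) = M / N := by rw [hM]; field_simp
  rw [hquot]
  refine (klDiv_compProd_prod_snd_le hh (fun x => (hκ x).trans
    (gaussianReal_eq_withDensity_gaussianReal (f x) 0 hN hM0)) (fun y => ?_) fun y => ?_).trans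
    (klDiv_compProd_prod_gaussianReal_le hf hfT hN hκ hM)
  · refine ((lintegral_pos_iff_support hh.of_uncurry_right).2 ?_).ne'
    have hsupp : (Function.support fun x => gaussianPDF (f x) N y / gaussianPDF 0 M y) =
        Set.univ := Set.eq_univ_of_forall fun x =>
      (ENNReal.div_pos (gaussianPDF_pos _ hN y).ne' gaussianPDF_ne_top).ne'
    rw [hsupp]
    simp
  -- the Gaussian density is bounded by its value at the mean, uniformly in `x`
  · have hle : ∀ x, gaussianPDF (f x) N y / gaussianPDF 0 M y ≤
        ENNReal.ofReal (√(2 * Real.pi * N))⁻¹ / gaussianPDF 0 M y := fun x => by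
      refine ENNReal.div_le_div_right (ENNReal.ofReal_le_ofReal ?_) _
      refine mul_le_of_le_one_right (by positivity) (Real.exp_le_one_iff.2 ?_)
      exact div_nonpos_of_nonpos_of_nonneg (neg_nonpos.2 (sq_nonneg _)) (by positivity)
    refine ((lintegral_mono hle).trans_lt ?_).ne
    rw [lintegral_const, measure_univ, mul_one]
    exact ENNReal.div_lt_top ENNReal.ofReal_ne_top (gaussianPDF_pos _ hM0 y).ne'

end Gaussian

/-! ### From one record to the whole dataset -/

theorem mutualInfo_recordOutputLaw_le {n : ℕ} {𝒳 : Fin n → Type*} [∀ i, MeasurableSpace (𝒳 i)]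
    {𝒴 : Type*} [MeasurableSpace 𝒴] (κ : Kernel (∀ i, 𝒳 i) 𝒴) [IsMarkovKernel κ]
    (P : ProbabilityMeasure (∀ i, 𝒳 i)) (i : Fin n) :
    mutualInfo (recordOutputLaw κ P i) ≤
      klDiv ((P : Measure (∀ i, 𝒳 i)) ⊗ₘ κ)
        ((P : Measure (∀ i, 𝒳 i)).prod ((P : Measure (∀ i, 𝒳 i)) ⊗ₘ κ).snd) := by
  set ρ := (P : Measure (∀ i, 𝒳 i)) ⊗ₘ κ with hρ
  have hg : Measurable fun z : (∀ i, 𝒳 i) × 𝒴 => (z.1 i, z.2) := by fun_prop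
  have hprod : (recordOutputLaw κ P i).fst.prod (recordOutputLaw κ P i).snd =
      ((P : Measure (∀ i, 𝒳 i)).prod ρ.snd).map fun z => (z.1 i, z.2) := by
    have hfst : (recordOutputLaw κ P i).fst =
        (P : Measure (∀ i, 𝒳 i)).map fun x => x i := by
      rw [recordOutputLaw, ← hρ, Measure.fst, Measure.map_map measurable_fst hg]
      conv_rhs => rw [← Measure.fst_compProd (P : Measure (∀ i, 𝒳 i)) κ, Measure.fst,
        Measure.map_map (measurable_pi_apply i) measurable_fst]
      rfl
    have hsnd : (recordOutputLaw κ P i).snd = ρ.snd := by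
      rw [recordOutputLaw, ← hρ, Measure.snd, Measure.map_map measurable_snd hg]
      rfl
    rw [hfst, hsnd]
    conv_lhs => rw [← Measure.map_id (μ := ρ.snd)]
    exact Measure.map_prod_map _ _ (measurable_pi_apply i) measurable_id
  rw [mutualInfo, hprod]
  exact klDiv_map_le _ _ hg

theorem mainTheorem4 {n : ℕ} {𝒳 : Fin n → Type*}
    [∀ i, TopologicalSpace (𝒳 i)] [∀ i, SecondCountableTopology (𝒳 i)]
    [∀ i, MeasurableSpace (𝒳 i)] [∀ i, BorelSpace (𝒳 i)]
    (f : (∀ i, 𝒳 i) → ℝ) (hf : Continuous f)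
    (T : ℝ) (hT : 0 < T) (hfT : ∀ x, f x ∈ Set.Icc (-T) T)
    (N : ℝ≥0) (hN : 0 < N)
    (κ : Kernel (∀ i, 𝒳 i) ℝ) (hκ : IsGaussianPrivacyChannel f N κ) :
    individualChannelCapacity κ Set.univ ≤
        ENNReal.ofReal (1 / 2 * Real.log (1 + T ^ 2 / (N : ℝ))) ∧
      ∀ ε : ℝ≥0, 0 < ε → T ^ 2 / (Real.exp (2 * (ε : ℝ)) - 1) ≤ (N : ℝ) →
        InformationPrivacy κ Set.univ ε := by
  have hκ' : ∀ x, κ x = gaussianReal (f x) N := hκ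
  have : IsMarkovKernel κ := ⟨fun x => by rw [hκ']; infer_instance⟩
  have hcap : individualChannelCapacity κ Set.univ ≤
      ENNReal.ofReal (1 / 2 * Real.log (1 + T ^ 2 / (N : ℝ))) :=
    iSup_le fun i => iSup₂_le fun P _ => (mutualInfo_recordOutputLaw_le κ P i).trans
      (klDiv_compProd_prod_snd_gaussian_le hf.measurable (fun x => abs_le.2 (hfT x)) hN.ne' hκ')
  refine ⟨hcap, fun ε hε hNε => hcap.trans ?_⟩
  have hN' : (0 : ℝ) < N := hN
  have hε' : (0 : ℝ) < ε := hε
  have hexp : 0 < Real.exp (2 * (ε : ℝ)) - 1 := sub_pos.2 (Real.one_lt_exp_iff.2 (by positivity))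
  have hsnr : T ^ 2 / (N : ℝ) ≤ Real.exp (2 * (ε : ℝ)) - 1 := (div_le_comm₀ hexp hN').1 hNε
  have hlog : Real.log (1 + T ^ 2 / (N : ℝ)) ≤ 2 * (ε : ℝ) :=
    (Real.log_le_iff_le_exp (by positivity)).2 (by linarith)
  rw [← ENNReal.ofReal_coe_nnreal]
  exact ENNReal.ofReal_le_ofReal (by linarith)
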